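/- All graphs are finite and simple. For a graph $G$, let $\gamma(G)$ be its domination number (the minimum size of a set $D\subseteq V(G)$ such that every vertex of $G$ is in $D$ or has a neighbor in $D$), let $\alpha(G)$ be its independence number, and let $\alpha_2(G)$ be its $2$-independence number (the maximum size of a set $A\subseteq V(G)$ such that any two distinct vertices of $A$ are at distance greater than $2$ in $G$). A class of graphs is monotone if it is closed under taking subgraphs (graphs being considered up to isomorphism); it has bounded average degree if there is a constant $t$ such that $2|E(G)|/|V(G)|\le t$ for every non-null graph $G$ in the class. A class $\mathcal{G}$ has bounded domination-to-2-independence ratio if there is a real number $C$ such that $\gamma(G)\le C\,\alpha_2(G)$ for every $G\in\mathcal{G}$. A cascade is a pair $(H,\psi)$, where $\psi$ is a proper coloring of a graph $H$ by the colors $\mathtt{v}$, $\mathtt{e}$, $\mathtt{d}$ such that every vertex of color $\mathtt{e}$ has exactly two neighbors of color $\mathtt{v}$ and exactly one neighbor of color $\mathtt{d}$, and $H$ has no other edges. Its foundation is the graph $F$ with vertex set $\psi^{-1}(\mathtt{v})$ in which two distinct vertices are adjacent if and only if they have a common neighbor (of color $\mathtt{e}$) in $H$. The slope of the cascade is $\dfrac{|\psi^{-1}(\mathtt{v})|}{\max(\alpha(F),|\psi^{-1}(\mathtt{d})|)}$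 (and $0$ if $H$ is the null graph). A class $\mathcal{G}$ contains the cascade $(H,\psi)$ if $H\in\mathcal{G}$. **Theorem 1.** Let $\mathcal{G}$ be a monotone class of graphs with bounded average degree. Then $\mathcal{G}$ has bounded domination-to-2-independence ratio if and only if there is a real number $c$ such that every cascade contained in $\mathcal{G}$ has slope at most $c$. -/

import Mathlib

namespace CascadeRatio

universe u

/-- A class of finite graphs: a predicate on graphs with finite vertex set. -/
def GraphClass : Type (u + 1) := ∀ (V : Type u) [Finite V], SimpleGraph V → Prop

/-- The class is monotone, i.e. closed under taking subgraphs. Graphs are taken up to isomorphism,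
so `H` is a subgraph of `G` when there is an injective homomorphism from `H` to `G`. -/
def GraphClass.IsMonotone (𝒢 : GraphClass.{u}) : Prop :=
  ∀ (V W : Type u) [Finite V] [Finite W] (G : SimpleGraph V) (H : SimpleGraph W),
    𝒢 V G → H.IsContained G → 𝒢 W H

/-- The average degree `2|E(G)| / |V(G)|` of a finite graph (`0` for the null graph). -/
noncomputable def averageDegree {V : Type u} (G : SimpleGraph V) : ℝ :=
  2 * (G.edgeSet.ncard : ℝ) / (Nat.card V : ℝ)

/-- The average degrees of the graphs in the class are bounded by a common constant. -/
def GraphClass.HasBoundedAverageDegree (𝒢 : GraphClass.{u}) : Prop :=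
  ∃ t : ℝ, ∀ (V : Type u) [Finite V] (G : SimpleGraph V), 𝒢 V G → averageDegree G ≤ t

/-- Every vertex of `G` belongs to `D` or has a neighbor in `D`. -/
def IsDominatingSet {V : Type u} (G : SimpleGraph V) (D : Finset V) : Prop :=
  ∀ x : V, x ∈ D ∨ ∃ y ∈ D, G.Adj x y

/-- The domination number: the minimum size of a dominating set. -/
noncomputable def dominationNumber {V : Type u} (G : SimpleGraph V) : ℕ :=
  sInf {k : ℕ | ∃ D : Finset V, IsDominatingSet G D ∧ D.card = k}

/-- Any two distinct vertices of `A` are at distance greater than two in `G`; vertices in different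
components are at infinite distance. -/
def IsTwoIndependentSet {V : Type u} (G : SimpleGraph V) (A : Finset V) : Prop :=
  ∀ x ∈ A, ∀ y ∈ A, x ≠ y → 2 < G.edist x y

/-- The `2`-independence number: the maximum size of a `2`-independent set. -/
noncomputable def twoIndependenceNumber {V : Type u} (G : SimpleGraph V) : ℕ :=
  sSup {k : ℕ | ∃ A : Finset V, IsTwoIndependentSet G A ∧ A.card = k}

/-- Bounded domination-to-2-independence ratio. The inequality is written without division;
`twoIndependenceNumber G` is positive unless `G` is the null graph. -/
def GraphClass.HasBoundedRatio (𝒢 : GraphClass.{u}) : Prop :=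
  ∃ C : ℝ, ∀ (V : Type u) [Finite V] (G : SimpleGraph V), 𝒢 V G →
    (dominationNumber G : ℝ) ≤ C * (twoIndependenceNumber G : ℝ)

/-- The three colors used in a cascade. -/
inductive Color : Type
  | v
  | e
  | d

/-- `(H, ψ)` is a cascade, where `ψ` is a proper coloring of `H` by the colors `v`, `e`, `d`. -/
structure IsCascade {V : Type u} (H : SimpleGraph V) (ψ : H.Coloring Color) : Prop where
  /-- A vertex of color `e` has exactly two neighbors of color `v`. -/
  two_v : ∀ x : V, ψ x = Color.e → {y : V | H.Adj x y ∧ ψ y = Color.v}.ncard = 2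
  /-- A vertex of color `e` has exactly one neighbor of color `d`. -/
  one_d : ∀ x : V, ψ x = Color.e → {y : V | H.Adj x y ∧ ψ y = Color.d}.ncard = 1
  /-- There are no other edges: every edge has an end of color `e`. -/
  no_other : ∀ x y : V, H.Adj x y → ψ x = Color.e ∨ ψ y = Color.e

/-- The foundation: the graph on the vertices of color `v` in which two distinct vertices are
adjacent if and only if they have a common neighbor of color `e` in `H`. -/
def foundation {V : Type u} (H : SimpleGraph V) (ψ : H.Coloring Color) :
    SimpleGraph {x : V // ψ x = Color.v} where
  Adj x y := x ≠ y ∧ ∃ z : V, ψ z = Color.e ∧ H.Adj x.1 z ∧ H.Adj y.1 z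
  symm := ⟨fun _ _ h => ⟨h.1.symm, h.2.imp fun _ hz => ⟨hz.1, hz.2.2, hz.2.1⟩⟩⟩
  loopless := ⟨fun _ h => h.1 rfl⟩

/-- The slope of a cascade: the number of vertices of color `v` divided by the maximum of the
independence number of the foundation and the number of vertices of color `d`. In a cascade the
denominator vanishes only for the null graph, and then the slope is `0`. -/
noncomputable def slope {V : Type u} (H : SimpleGraph V) (ψ : H.Coloring Color) : ℝ :=
  (Nat.card {x : V // ψ x = Color.v} : ℝ) /
    max ((foundation H ψ).indepNum : ℝ) (Nat.card {x : V // ψ x = Color.d} : ℝ)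

/-- Every cascade `(H, ψ)` with `H` in the class has slope at most some common constant. -/
def GraphClass.HasBoundedSlopes (𝒢 : GraphClass.{u}) : Prop :=
  ∃ c : ℝ, ∀ (V : Type u) [Finite V] (H : SimpleGraph V) (ψ : H.Coloring Color),
    𝒢 V H → IsCascade H ψ → slope H ψ ≤ c

end CascadeRatio

/-!
The domination number of a cascade is at least half the number of vertices of color `v`, since a
vertex dominates at most two of them. A `2`-independent set meets the color `v` in an independent
set of the foundation, and the colors `e` and `d` in at most as many vertices as there are of color
`d`. So a bounded ratio bounds the slopes (`GraphClass.HasBoundedRatio.hasBoundedSlopes`).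

Conversely, let `c` bound the slopes. Bounded average degree in a monotone class means bounded
degeneracy, so each graph of the class has an orientation with out-degrees at most a constant `k`
(`GraphClass.exists_orientation`). For a large constant `M`, take a maximal vertex set `S` such that
every vertex has at most `M` in-neighbors in `S` (`exists_maximal_card_in_le`), and let `Z` be the
set of vertices with exactly `M` of them. By maximality every vertex outside `S` has an out-neighbor
in `Z`, so `S ∪ Z` is dominating, while double counting gives `M * #Z ≤ k * #S`. Hence the
domination number is at most `2 * #S`, and it remains to find a `2`-independent set of size
proportional to `#S`.

A pair of vertices of `S` at distance at most two is either adjacent or joined by a path with some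
middle vertex `z`. Pairs that are adjacent, or for which `z` is an out-neighbor of one of the two
vertices, or for which `z ∈ S`, form digraphs of bounded out-degree (after discarding part of `S`),
and are removed greedily by `exists_independent_of_outdegree_le`. What remains are pairs that are
both out-neighbors of a vertex `z ∉ S`. Such a `z` has a neighbor in `Z`, so choosing one pair for
each `z` gives a cascade whose colors `v`, `e`, `d` are the rest of `S`, the vertices `z`, and `Z`.
As `Z` is tiny compared to `S`, the bound on the slope provides an independent set of the foundation
of proportion `1 / c`. Passing to it lowers the number of out-neighbors of each `z` in the set, so
`k` repetitions suffice (`exists_subset_card_out_inter_le_one`).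
-/

namespace CascadeRatio

universe u

open Finset

/-! ### Independent sets in digraphs of bounded out-degree -/

/-- A digraph in which every vertex of `S` has at most `k` out-neighbors in `S` has an independent
set of proportion at least `1 / (2k + 1)` in `S`: in every subset some vertex has total degree at
most `2k`, so the greedy algorithm applies. -/
theorem exists_independent_of_outdegree_le {V : Type*} (R : V → V → Prop) [DecidableEq V]
    [DecidableRel R] (k : ℕ) (S : Finset V) (h : ∀ x ∈ S, #{y ∈ S | R x y} ≤ k) :
    ∃ I ⊆ S, (∀ x ∈ I, ∀ y ∈ I, x ≠ y → ¬ R x y) ∧ #S ≤ (2 * k + 1) * #I := by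
  induction S using Finset.strongInduction with
  | H S ih =>
  rcases S.eq_empty_or_nonempty with rfl | hS
  · exact ⟨∅, by simp⟩
  obtain ⟨x, hx, hxin⟩ : ∃ x ∈ S, #{y ∈ S | R y x} ≤ k := by
    by_contra! hcon
    have h1 : ∑ x ∈ S, #{y ∈ S | R x y} = ∑ x ∈ S, #{y ∈ S | R y x} :=
      sum_card_bipartiteAbove_eq_sum_card_bipartiteBelow R
    have h2 : ∑ x ∈ S, #{y ∈ S | R x y} ≤ ∑ _x ∈ S, k := sum_le_sum h
    have h3 : ∑ _x ∈ S, k < ∑ x ∈ S, #{y ∈ S | R y x} := sum_lt_sum_of_nonempty hS hcon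
    omega
  set N : Finset V := insert x ({y ∈ S | R x y} ∪ {y ∈ S | R y x}) with hN
  have hNcard : #N ≤ 2 * k + 1 := by
    have h1 := card_insert_le x ({y ∈ S | R x y} ∪ {y ∈ S | R y x})
    have h2 := card_union_le {y ∈ S | R x y} {y ∈ S | R y x}
    have h3 := h x hx
    rw [hN]
    omega
  have hss : S \ N ⊂ S :=
    ssubset_iff_of_subset sdiff_subset |>.2 ⟨x, hx, by simp [hN]⟩
  obtain ⟨I, hIS, hI, hcard⟩ := ih (S \ N) hss fun y hy =>
    (card_le_card (filter_subset_filter _ sdiff_subset)).trans (h y (sdiff_subset hy))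
  have hxI : x ∉ I := fun hxI => by simpa [hN] using hIS hxI
  refine ⟨insert x I, insert_subset hx (hIS.trans sdiff_subset), ?_, ?_⟩
  · have key : ∀ y ∈ I, ¬ R x y ∧ ¬ R y x := fun y hy => by
      have := hIS hy
      simp only [hN, mem_sdiff, mem_insert, mem_union, mem_filter] at this
      tauto
    intro a ha b hb hab
    rcases mem_insert.1 ha with rfl | ha' <;> rcases mem_insert.1 hb with rfl | hb'
    · exact absurd rfl hab
    · exact (key b hb').1
    · exact (key a ha').2
    · exact hI a ha' b hb' hab
  · rw [card_insert_of_notMem hxI]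
    have := card_le_card_sdiff_add_card (s := S) (t := N)
    rw [mul_add]
    omega

/-! ### Orientations of bounded out-degree -/

/-- An orientation of `G` with out-degrees at most `k`, given by the out-neighborhoods; an edge may
be oriented both ways. -/
structure IsOrientation {V : Type u} (G : SimpleGraph V) (out : V → Finset V) (k : ℕ) : Prop where
  adj : ∀ x, ∀ y ∈ out x, G.Adj x y
  mem_or_mem : ∀ x y, G.Adj x y → y ∈ out x ∨ x ∈ out y
  card_le : ∀ x, #(out x) ≤ k

theorem exists_orientation_of_degenerate {V : Type u} [Fintype V] [DecidableEq V]
    (G : SimpleGraph V) [DecidableRel G.Adj] (k : ℕ)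
    (h : ∀ T : Finset V, T.Nonempty → ∃ x ∈ T, #{y ∈ T | G.Adj x y} ≤ k) :
    ∃ out, IsOrientation G out k := by
  suffices H : ∀ T : Finset V, ∃ out : V → Finset V, (∀ x, ∀ y ∈ out x, G.Adj x y) ∧
      (∀ x ∈ T, ∀ y ∈ T, G.Adj x y → y ∈ out x ∨ x ∈ out y) ∧ ∀ x, #(out x) ≤ k by
    obtain ⟨out, h1, h2, h3⟩ := H univ
    exact ⟨out, h1, fun x y => h2 x (mem_univ x) y (mem_univ y), h3⟩
  intro T
  induction T using Finset.strongInduction with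
  | H T ih =>
  rcases T.eq_empty_or_nonempty with rfl | hT
  · exact ⟨fun _ => ∅, by simp⟩
  obtain ⟨v, hv, hvk⟩ := h T hT
  obtain ⟨out, h1, h2, h3⟩ := ih (T.erase v) (erase_ssubset hv)
  refine ⟨Function.update out v {y ∈ T | G.Adj v y}, fun x y hy => ?_, fun x hx y hy hxy => ?_,
    fun x => ?_⟩
  · rcases eq_or_ne x v with rfl | hxv
    · rw [Function.update_self] at hy
      exact (mem_filter.1 hy).2
    · rw [Function.update_of_ne hxv] at hy
      exact h1 x y hy
  · rcases eq_or_ne x v with rfl | hxv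
    · left
      rw [Function.update_self]
      exact mem_filter.2 ⟨hy, hxy⟩
    rcases eq_or_ne y v with rfl | hyv
    · right
      rw [Function.update_self]
      exact mem_filter.2 ⟨hx, hxy.symm⟩
    rw [Function.update_of_ne hxv, Function.update_of_ne hyv]
    exact h2 x (mem_erase.2 ⟨hxv, hx⟩) y (mem_erase.2 ⟨hyv, hy⟩) hxy
  · rcases eq_or_ne x v with rfl | hxv
    · rwa [Function.update_self]
    · rw [Function.update_of_ne hxv]
      exact h3 x

/-- In a monotone class of bounded average degree, every member is degenerate, since every induced
subgraph has a vertex of at most average degree. -/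
theorem GraphClass.exists_orientation {𝒢 : GraphClass.{u}} (hmono : 𝒢.IsMonotone)
    (hdeg : 𝒢.HasBoundedAverageDegree) :
    ∃ k : ℕ, ∀ (V : Type u) [Finite V] (G : SimpleGraph V), 𝒢 V G →
      ∃ out, IsOrientation G out k := by
  classical
  obtain ⟨t, ht⟩ := hdeg
  refine ⟨⌈t⌉₊, fun V _ G hG => ?_⟩
  have := Fintype.ofFinite V
  refine exists_orientation_of_degenerate G _ fun T hT => ?_
  by_contra! hcon
  have hind := ht T (G.induce (T : Set V))
    (hmono _ _ G _ hG ⟨(SimpleGraph.Embedding.induce _).toCopy⟩)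
  have hpos : (0 : ℝ) < #T := by exact_mod_cast hT.card_pos
  rw [averageDegree, div_le_iff₀ (by simpa using hpos)] at hind
  have hdeg : ∀ x : (T : Set V), (G.induce (T : Set V)).degree x = #{y ∈ T | G.Adj x y} := by
    intro x
    rw [← SimpleGraph.card_neighborFinset_eq_degree]
    refine card_bij (fun y _ => y.1) ?_ ?_ ?_
    · intro y hy
      have := y.2
      simp_all
    · exact fun _ _ _ _ h => Subtype.ext h
    · intro y hy
      rw [mem_filter] at hy
      exact ⟨⟨y, hy.1⟩, by simpa using hy.2, rfl⟩
  have hsum := (G.induce (T : Set V)).sum_degrees_eq_twice_card_edges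
  have hlt : ∑ _x : (T : Set V), ⌈t⌉₊ < ∑ x, (G.induce (T : Set V)).degree x := by
    refine sum_lt_sum_of_nonempty ⟨⟨_, hT.choose_spec⟩, mem_univ _⟩ fun x _ => ?_
    rw [hdeg]
    exact hcon x x.2
  rw [hsum, sum_const, smul_eq_mul, card_univ, Fintype.card_eq_nat_card] at hlt
  rw [← SimpleGraph.coe_edgeFinset, Set.ncard_coe_finset] at hind
  have hlt' : (Nat.card (T : Set V) : ℝ) * ⌈t⌉₊ < 2 * #(G.induce (T : Set V)).edgeFinset := by
    exact_mod_cast hlt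
  have : t * Nat.card (T : Set V) ≤ Nat.card (T : Set V) * ⌈t⌉₊ := by
    rw [mul_comm]
    exact mul_le_mul_of_nonneg_left (Nat.le_ceil t) (Nat.cast_nonneg _)
  exact absurd (hlt'.trans_le (hind.trans this)) (lt_irrefl _)

/-! ### Cascades from orientations -/

/-- The graph on the disjoint union of `S`, `E` and `Z` in which each `z ∈ E` is joined to `f z`
and `g z` in `S` and to `d z` in `Z`. -/
def cascadeGraph {V : Type u} (S E Z : Finset V) (f g d : V → V) : SimpleGraph (S ⊕ E ⊕ Z) :=
  SimpleGraph.fromRel fun x y =>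
    match x, y with
    | .inr (.inl z), .inl s => s.1 = f z ∨ s.1 = g z
    | .inr (.inl z), .inr (.inr w) => w.1 = d z
    | _, _ => False

/-- The coloring of `cascadeGraph` with color classes `S`, `E` and `Z`. -/
def cascadeColoring {V : Type u} (S E Z : Finset V) (f g d : V → V) :
    (cascadeGraph S E Z f g d).Coloring Color :=
  SimpleGraph.Coloring.mk
    (fun | .inl _ => Color.v | .inr (.inl _) => Color.e | .inr (.inr _) => Color.d) <| by
    rintro (x | x | x) (y | y | y) <;> simp [cascadeGraph]

theorem isCascade_cascadeColoring {V : Type u} {S E Z : Finset V} {f g d : V → V}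
    (hf : ∀ z ∈ E, f z ∈ S) (hg : ∀ z ∈ E, g z ∈ S) (hd : ∀ z ∈ E, d z ∈ Z)
    (hfg : ∀ z ∈ E, f z ≠ g z) :
    IsCascade (cascadeGraph S E Z f g d) (cascadeColoring S E Z f g d) where
  two_v := by
    rintro (x | x | x) hx
    · cases hx
    · rw [Set.ncard_eq_two]
      refine ⟨.inl ⟨f x, hf x x.2⟩, .inl ⟨g x, hg x x.2⟩, ?_, ?_⟩
      · simpa using hfg x x.2
      · ext (y | y | y)
        · have h : cascadeColoring S E Z f g d (.inl y) = Color.v := rfl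
          obtain ⟨y, hy⟩ := y
          simpa [cascadeGraph] using fun _ => h
        · have h : cascadeColoring S E Z f g d (.inr (.inl y)) ≠ Color.v := nofun
          simp [h]
        · have h : cascadeColoring S E Z f g d (.inr (.inr y)) ≠ Color.v := nofun
          simp [h]
    · cases hx
  one_d := by
    rintro (x | x | x) hx
    · cases hx
    · rw [Set.ncard_eq_one]
      refine ⟨.inr (.inr ⟨d x, hd x x.2⟩), ?_⟩
      ext (y | y | y)
      · have h : cascadeColoring S E Z f g d (.inl y) ≠ Color.d := nofun
        simp [h]
      · have h : cascadeColoring S E Z f g d (.inr (.inl y)) ≠ Color.d := nofun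
        simp [h]
      · have h : cascadeColoring S E Z f g d (.inr (.inr y)) = Color.d := rfl
        obtain ⟨y, hy⟩ := y
        simpa [cascadeGraph] using fun _ => h
    · cases hx
  no_other := by
    rintro (x | x | x) (y | y | y) h <;>
      first | exact Or.inl rfl | exact Or.inr rfl | simp [cascadeGraph] at h

theorem cascadeGraph_isContained {V : Type u} (G : SimpleGraph V) {S E Z : Finset V}
    {f g d : V → V} (hSE : Disjoint S E) (hSZ : Disjoint S Z) (hEZ : Disjoint E Z)
    (hf : ∀ z ∈ E, G.Adj z (f z)) (hg : ∀ z ∈ E, G.Adj z (g z)) (hd : ∀ z ∈ E, G.Adj z (d z)) :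
    (cascadeGraph S E Z f g d).IsContained G := by
  rw [Finset.disjoint_left] at *
  refine ⟨⟨⟨Sum.elim Subtype.val (Sum.elim Subtype.val Subtype.val), ?_⟩, ?_⟩⟩
  · rintro (⟨x, hx⟩ | ⟨x, hx⟩ | ⟨x, hx⟩) (⟨y, hy⟩ | ⟨y, hy⟩ | ⟨y, hy⟩) <;>
      simp only [cascadeGraph, SimpleGraph.fromRel_adj, Sum.elim_inl, Sum.elim_inr, or_false,
        false_or, and_false, or_self, IsEmpty.forall_iff]
    · rintro ⟨-, rfl | rfl⟩
      exacts [(hf y hy).symm, (hg y hy).symm]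
    · rintro ⟨-, rfl | rfl⟩
      exacts [hf x hx, hg x hx]
    · rintro ⟨-, rfl⟩
      exact hd x hx
    · rintro ⟨-, rfl⟩
      exact (hd y hy).symm
  · rintro (⟨x, hx⟩ | ⟨x, hx⟩ | ⟨x, hx⟩) (⟨y, hy⟩ | ⟨y, hy⟩ | ⟨y, hy⟩) h <;>
      simp only [RelHom.coeFn_mk, Sum.elim_inl, Sum.elim_inr] at h <;> subst h <;>
      first | rfl | (exfalso; solve_by_elim)

/-- If every cascade in the class has slope at most `c`, and `Z` is much smaller than `S`, then the
cascade with color classes `S`, `E`, `Z` yields a large subset of `S` containing at most one of the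
two vertices `f z`, `g z` for each `z ∈ E`. -/
theorem exists_independent_of_slope_le {𝒢 : GraphClass.{u}} (hmono : 𝒢.IsMonotone) {c : ℕ}
    (hc : ∀ (V : Type u) [Finite V] (H : SimpleGraph V) (ψ : H.Coloring Color),
      𝒢 V H → IsCascade H ψ → slope H ψ ≤ c)
    {V : Type u} [Finite V] {G : SimpleGraph V} (hG : 𝒢 V G) {S E Z : Finset V}
    {f g d : V → V} (hSE : Disjoint S E) (hSZ : Disjoint S Z) (hEZ : Disjoint E Z)
    (hf : ∀ z ∈ E, f z ∈ S ∧ G.Adj z (f z)) (hg : ∀ z ∈ E, g z ∈ S ∧ G.Adj z (g z))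
    (hd : ∀ z ∈ E, d z ∈ Z ∧ G.Adj z (d z)) (hfg : ∀ z ∈ E, f z ≠ g z) (hcZ : c * #Z < #S) :
    ∃ I ⊆ S, #S ≤ c * #I ∧ ∀ z ∈ E, ¬ (f z ∈ I ∧ g z ∈ I) := by
  classical
  have hslope := hc _ (cascadeGraph S E Z f g d) (cascadeColoring S E Z f g d)
    (hmono _ _ G _ hG (cascadeGraph_isContained G hSE hSZ hEZ (fun z hz => (hf z hz).2)
      (fun z hz => (hg z hz).2) fun z hz => (hd z hz).2))
    (isCascade_cascadeColoring (fun z hz => (hf z hz).1) (fun z hz => (hg z hz).1)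
      (fun z hz => (hd z hz).1) hfg)
  set H := cascadeGraph S E Z f g d with hH
  set ψ := cascadeColoring S E Z f g d with hψ
  let eS : S ≃ {x // ψ x = Color.v} :=
    { toFun := fun s => ⟨.inl s, rfl⟩
      invFun := fun x => match x with
        | ⟨.inl s, _⟩ => s
        | ⟨.inr (.inl _), h⟩ => nomatch h
        | ⟨.inr (.inr _), h⟩ => nomatch h
      left_inv := fun s => rfl
      right_inv := by
        rintro ⟨s | s | s, h⟩
        · rfl
        · exact nomatch h
        · exact nomatch h }
  let eZ : Z ≃ {x // ψ x = Color.d} :=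
    { toFun := fun s => ⟨.inr (.inr s), rfl⟩
      invFun := fun x => match x with
        | ⟨.inr (.inr s), _⟩ => s
        | ⟨.inl _, h⟩ => nomatch h
        | ⟨.inr (.inl _), h⟩ => nomatch h
      left_inv := fun s => rfl
      right_inv := by
        rintro ⟨s | s | s, h⟩
        · exact nomatch h
        · exact nomatch h
        · rfl }
  have hcardS : Nat.card {x // ψ x = Color.v} = #S := by
    rw [← Nat.card_congr eS]; simp
  have hcardZ : Nat.card {x // ψ x = Color.d} = #Z := by
    rw [← Nat.card_congr eZ]; simp
  have : Fintype {x // ψ x = Color.v} := Fintype.ofFinite _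
  obtain ⟨J, hJ⟩ := (foundation H ψ).exists_isNIndepSet_indepNum
  rw [slope, hcardS, hcardZ] at hslope
  refine ⟨J.map (eS.symm.toEmbedding.trans (Function.Embedding.subtype _)), ?_, ?_, ?_⟩
  · intro x hx
    obtain ⟨y, -, rfl⟩ := mem_map.1 hx
    exact (eS.symm y).2
  · rw [card_map, hJ.card_eq]
    -- A single vertex of `S` is independent, so the denominator of the slope does not vanish.
    have hpos : 0 < (foundation H ψ).indepNum := by
      obtain ⟨s, hs⟩ : S.Nonempty := card_pos.1 (by omega)
      have : (foundation H ψ).IsIndepSet (({eS ⟨s, hs⟩} : Finset _) : Set _) := by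
        simp [SimpleGraph.IsIndepSet]
      exact (card_singleton _).symm.le.trans this.card_le_indepNum
    rw [div_le_iff₀ (lt_max_of_lt_left (by exact_mod_cast hpos))] at hslope
    have h2 : #S ≤ c * max (foundation H ψ).indepNum #Z := by exact_mod_cast hslope
    rcases le_total (foundation H ψ).indepNum #Z with h | h
    · rw [max_eq_right h] at h2
      omega
    · rwa [max_eq_left h] at h2
  · rintro z hz ⟨h1, h2⟩
    obtain ⟨x, hx, hxf⟩ := mem_map.1 h1
    obtain ⟨y, hy, hyg⟩ := mem_map.1 h2
    obtain ⟨x, rfl⟩ := eS.surjective x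
    obtain ⟨y, rfl⟩ := eS.surjective y
    simp only [Function.Embedding.trans_apply, Equiv.coe_toEmbedding, Equiv.symm_apply_apply,
      Function.Embedding.subtype_apply] at hxf hyg
    have hne : eS x ≠ eS y := fun h => hfg z hz (by rw [← hxf, ← hyg, eS.injective h])
    refine hJ.isIndepSet hx hy hne ⟨hne, .inr (.inl ⟨z, hz⟩), rfl, ?_, ?_⟩
    · simp [hH, cascadeGraph, eS, hxf]
    · simp [hH, cascadeGraph, eS, hyg]

/-- If every vertex with two out-neighbors in `S` lies outside `S ∪ Z` and has a neighbor in `Z`,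
then some large subset `I` of `S` contains at most one out-neighbor of every vertex. Each
application of `exists_independent_of_slope_le`, to one pair of out-neighbors for each vertex that
has two, lowers the maximum number of out-neighbors in the subset. -/
theorem exists_subset_card_out_inter_le_one {𝒢 : GraphClass.{u}} (hmono : 𝒢.IsMonotone) {c : ℕ}
    (hc1 : 1 ≤ c)
    (hc : ∀ (V : Type u) [Finite V] (H : SimpleGraph V) (ψ : H.Coloring Color),
      𝒢 V H → IsCascade H ψ → slope H ψ ≤ c)
    {V : Type u} [Finite V] [DecidableEq V] {G : SimpleGraph V} (hG : 𝒢 V G) {out : V → Finset V}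
    (hout : ∀ x, ∀ y ∈ out x, G.Adj x y) (Z : Finset V) (m : ℕ) (S : Finset V)
    (hSZ : Disjoint S Z)
    (hS : ∀ z, 2 ≤ #(out z ∩ S) → z ∉ S ∧ z ∉ Z ∧ ∃ w ∈ Z, G.Adj z w)
    (hm : ∀ z, #(out z ∩ S) ≤ m + 1) (hcZ : c ^ m * #Z < #S) :
    ∃ I ⊆ S, #S ≤ c ^ m * #I ∧ ∀ z, #(out z ∩ I) ≤ 1 := by
  have := Fintype.ofFinite V
  induction m generalizing S with
  | zero => exact ⟨S, subset_rfl, by simp, hm⟩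
  | succ m ih =>
    set E : Finset V := {z | 2 ≤ #(out z ∩ S)} with hE
    have hE' : ∀ z ∈ E, 2 ≤ #(out z ∩ S) := fun z hz => (mem_filter.1 hz).2
    have hpair : ∀ z, ∃ p : V × V × V, z ∈ E → p.1 ∈ out z ∩ S ∧ p.2.1 ∈ out z ∩ S ∧
        p.1 ≠ p.2.1 ∧ p.2.2 ∈ Z ∧ G.Adj z p.2.2 := by
      intro z
      by_cases hz : z ∈ E
      · obtain ⟨a, ha, b, hb, hab⟩ := one_lt_card.1 (hE' z hz)
        obtain ⟨-, -, w, hw, hzw⟩ := hS z (hE' z hz)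
        exact ⟨(a, b, w), fun _ => ⟨ha, hb, hab, hw, hzw⟩⟩
      · exact ⟨(z, z, z), fun h => absurd h hz⟩
    choose p hp using hpair
    have hcm : 1 ≤ c ^ m := Nat.one_le_pow _ _ hc1
    rw [pow_succ] at hcZ
    have hcZ' : c * #Z < #S := lt_of_le_of_lt (by nlinarith [Nat.zero_le (c * #Z)]) hcZ
    obtain ⟨I, hIS, hcard, hI⟩ := exists_independent_of_slope_le hmono hc hG (S := S) (E := E)
      (Z := Z) (f := fun z => (p z).1) (g := fun z => (p z).2.1) (d := fun z => (p z).2.2)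
      (Finset.disjoint_right.2 fun z hz => (hS z (hE' z hz)).1) hSZ
      (Finset.disjoint_left.2 fun z hz => (hS z (hE' z hz)).2.1)
      (fun z hz => ⟨(mem_inter.1 (hp z hz).1).2, hout _ _ (mem_inter.1 (hp z hz).1).1⟩)
      (fun z hz => ⟨(mem_inter.1 (hp z hz).2.1).2, hout _ _ (mem_inter.1 (hp z hz).2.1).1⟩)
      (fun z hz => (hp z hz).2.2.2) (fun z hz => (hp z hz).2.2.1) hcZ'
    have hsub : ∀ z, out z ∩ I ⊆ out z ∩ S := fun z => inter_subset_inter_left hIS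
    obtain ⟨I', hI'I, hcard', hI'⟩ := ih I (hSZ.mono_left hIS)
      (fun z hz => by
        obtain ⟨h1, h2⟩ := hS z (hz.trans (card_le_card (hsub z)))
        exact ⟨fun h => h1 (hIS h), h2⟩)
      (fun z => by
        by_cases hz : z ∈ E
        · have hss : out z ∩ I ⊂ out z ∩ S := by
            refine (hsub z).ssubset_of_ne fun heq => hI z hz ⟨?_, ?_⟩
            · exact (mem_inter.1 (heq ▸ (hp z hz).1)).2
            · exact (mem_inter.1 (heq ▸ (hp z hz).2.1)).2
          have := card_lt_card hss
          have := hm z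
          omega
        · have h1 : ¬ 2 ≤ #(out z ∩ S) := fun h => hz (mem_filter.2 ⟨mem_univ z, h⟩)
          have := card_le_card (hsub z)
          omega)
      (by
        have h : c * (c ^ m * #Z) < c * #I := by
          calc c * (c ^ m * #Z) = c ^ m * c * #Z := by ring
            _ < #S := hcZ
            _ ≤ c * #I := hcard
        exact lt_of_mul_lt_mul_left h (Nat.zero_le c))
    refine ⟨I', hI'I.trans hIS, ?_, hI'⟩
    calc #S ≤ c * #I := hcard
      _ ≤ c * (c ^ m * #I') := Nat.mul_le_mul_left c hcard'
      _ = c ^ (m + 1) * #I' := by ring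

/-! ### Domination and 2-independence numbers -/

theorem dominationNumber_le {V : Type u} {G : SimpleGraph V} {D : Finset V}
    (hD : IsDominatingSet G D) : dominationNumber G ≤ #D :=
  Nat.sInf_le ⟨D, hD, rfl⟩

theorem exists_isDominatingSet {V : Type u} [Finite V] (G : SimpleGraph V) :
    ∃ D : Finset V, IsDominatingSet G D ∧ #D = dominationNumber G := by
  have := Fintype.ofFinite V
  exact Nat.sInf_mem (s := {k : ℕ | ∃ D : Finset V, IsDominatingSet G D ∧ #D = k})
    ⟨_, univ, fun x => Or.inl (mem_univ x), rfl⟩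

theorem bddAbove_twoIndependent {V : Type u} [Finite V] (G : SimpleGraph V) :
    BddAbove {k : ℕ | ∃ A : Finset V, IsTwoIndependentSet G A ∧ #A = k} := by
  have := Fintype.ofFinite V
  exact ⟨Fintype.card V, by rintro _ ⟨A, -, rfl⟩; exact card_le_univ A⟩

theorem le_twoIndependenceNumber {V : Type u} [Finite V] {G : SimpleGraph V} {A : Finset V}
    (hA : IsTwoIndependentSet G A) : #A ≤ twoIndependenceNumber G :=
  le_csSup (bddAbove_twoIndependent G) ⟨A, hA, rfl⟩

theorem exists_isTwoIndependentSet {V : Type u} [Finite V] (G : SimpleGraph V) :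
    ∃ A : Finset V, IsTwoIndependentSet G A ∧ #A = twoIndependenceNumber G :=
  Nat.sSup_mem (s := {k : ℕ | ∃ A : Finset V, IsTwoIndependentSet G A ∧ #A = k})
    ⟨_, ∅, by simp [IsTwoIndependentSet], rfl⟩ (bddAbove_twoIndependent G)

theorem isTwoIndependentSet_iff {V : Type u} {G : SimpleGraph V} {A : Finset V} :
    IsTwoIndependentSet G A ↔
      ∀ x ∈ A, ∀ y ∈ A, x ≠ y → ¬ G.Adj x y ∧ ∀ z, ¬ (G.Adj x z ∧ G.Adj z y) := by
  refine forall₂_congr fun x _ => forall₂_congr fun y _ => forall_congr' fun hxy => ?_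
  constructor
  · intro h
    have key : ∀ p : G.Walk x y, 2 < p.length := fun p => by
      exact_mod_cast h.trans_le p.edist_le
    refine ⟨fun hadj => ?_, fun z hz => ?_⟩
    · simpa using key hadj.toWalk
    · simpa using key (.cons hz.1 hz.2.toWalk)
  · rintro ⟨h1, h2⟩
    by_contra! hle
    obtain ⟨p, hp⟩ := SimpleGraph.exists_walk_of_edist_ne_top (ne_top_of_le_ne_top (by simp) hle)
    rw [← hp] at hle
    have hlen : p.length ≤ 2 := by exact_mod_cast hle
    match p, hlen with
    | .nil, _ => exact hxy rfl
    | .cons h .nil, _ => exact h1 h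
    | .cons h (.cons h' .nil), _ => exact h2 _ ⟨h, h'⟩
    | .cons _ (.cons _ (.cons _ _)), hlen => simp at hlen

/-! ### The ratio bounds the slopes -/

/-- Cascades of large slope have a large ratio, even without the assumption on the average degree:
with `n` vertices of color `v`, `δ` vertices of color `d`, and a foundation of independence number
`a`, the domination number is at least `n / 2` and the `2`-independence number at most
`a + 2 * δ`. -/
theorem GraphClass.HasBoundedRatio.hasBoundedSlopes {𝒢 : GraphClass.{u}}
    (h : 𝒢.HasBoundedRatio) : 𝒢.HasBoundedSlopes := by
  classical
  obtain ⟨C, hC⟩ := h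
  refine ⟨6 * max C 0, fun V _ H ψ hH hψ => ?_⟩
  have := Fintype.ofFinite V
  have hratio := hC V H hH
  have : Fintype {x : V // ψ x = Color.v} := Fintype.ofFinite _
  set n := Nat.card {x : V // ψ x = Color.v} with hn
  set a := (foundation H ψ).indepNum with ha
  set δ := Nat.card {x : V // ψ x = Color.d} with hδ
  have hn' : n = #{x : V | ψ x = Color.v} := by
    rw [hn, Nat.card_eq_fintype_card, Fintype.card_subtype]
  have hδ' : δ = #{x : V | ψ x = Color.d} := by
    rw [hδ, Nat.card_eq_fintype_card, Fintype.card_subtype]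
  -- Every vertex dominates at most two vertices of color `v`.
  have hdom : n ≤ 2 * dominationNumber H := by
    obtain ⟨D, hD, hDcard⟩ := exists_isDominatingSet H
    rw [← hDcard, hn', mul_comm]
    have hsub : ({x : V | ψ x = Color.v} : Finset V) ⊆
        D.biUnion fun y => {x : V | ψ x = Color.v ∧ (x = y ∨ H.Adj y x)} := by
      intro x hx
      rw [mem_filter] at hx
      rcases hD x with h | ⟨y, hy, hxy⟩
      · exact mem_biUnion.2 ⟨x, h, by simp [hx.2]⟩
      · exact mem_biUnion.2 ⟨y, hy, by simp [hx.2, hxy.symm]⟩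
    refine (card_le_card hsub).trans (card_biUnion_le_card_mul _ _ _ fun y _ => ?_)
    by_cases hy : ψ y = Color.e
    · rw [← hψ.two_v y hy, ← Set.ncard_coe_finset]
      refine Set.ncard_le_ncard (fun x hx => ?_) (Set.toFinite _)
      simp only [coe_filter, mem_univ, true_and, Set.mem_ofPred_eq] at hx
      rcases hx with ⟨hx, rfl | hxy⟩
      · rw [hx] at hy
        cases hy
      · exact ⟨hxy, hx⟩
    · refine (card_le_card (t := {y}) fun x hx => ?_).trans (by simp)
      simp only [mem_filter, mem_univ, true_and] at hx
      rcases hx with ⟨hx, rfl | hxy⟩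
      · simp
      · rcases hψ.no_other y x hxy with h | h
        · exact absurd h hy
        · rw [hx] at h
          cases h
  have hind : twoIndependenceNumber H ≤ a + 2 * δ := by
    obtain ⟨A, hA, hAcard⟩ := exists_isTwoIndependentSet H
    rw [isTwoIndependentSet_iff] at hA
    have hsplit : A ⊆ A.filter (ψ · = Color.v) ∪ (A.filter (ψ · = Color.e) ∪
        A.filter (ψ · = Color.d)) := by
      intro x hx
      cases h : ψ x <;> simp [hx, h]
    have hv : #(A.filter (ψ · = Color.v)) ≤ a := by
      have hindep : (foundation H ψ).IsIndepSet
          ((A.subtype (ψ · = Color.v) : Finset _) : Set {x : V // ψ x = Color.v}) := by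
        rintro x hx y hy hxy ⟨-, z, -, hz⟩
        rw [mem_coe, mem_subtype] at hx hy
        exact (hA x hx y hy (fun h => hxy (Subtype.ext h))).2 z ⟨hz.1, hz.2.symm⟩
      rw [← card_subtype]
      exact hindep.card_le_indepNum
    -- Distinct vertices of color `e` in `A` have distinct neighbors of color `d`.
    have he : #(A.filter (ψ · = Color.e)) ≤ δ := by
      have hex : ∀ x, ∃ w, ψ x = Color.e → H.Adj x w ∧ ψ w = Color.d := fun x => by
        by_cases hx : ψ x = Color.e
        · obtain ⟨w, hw⟩ := Set.ncard_eq_one.1 (hψ.one_d x hx)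
          exact ⟨w, fun _ => (hw.symm ▸ rfl : w ∈ {y : V | H.Adj x y ∧ ψ y = Color.d})⟩
        · exact ⟨x, fun h => absurd h hx⟩
      choose w hw using hex
      rw [hδ']
      refine card_le_card_of_injOn w (fun x hx => ?_) fun x hx y hy hxy => ?_
      · simpa using (hw x (mem_filter.1 hx).2).2
      · have hx := mem_filter.1 hx
        have hy := mem_filter.1 hy
        by_contra hne
        exact (hA x hx.1 y hy.1 hne).2 (w x) ⟨(hw x hx.2).1, hxy ▸ (hw y hy.2).1.symm⟩
    have hd : #(A.filter (ψ · = Color.d)) ≤ δ := by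
      rw [hδ']
      exact card_le_card (filter_subset_filter _ (subset_univ _))
    have h1 := card_le_card hsplit
    have h2 := card_union_le (A.filter (ψ · = Color.v))
      (A.filter (ψ · = Color.e) ∪ A.filter (ψ · = Color.d))
    have h3 := card_union_le (A.filter (ψ · = Color.e)) (A.filter (ψ · = Color.d))
    omega
  rw [slope, ← hn, ← ha, ← hδ]
  refine div_le_of_le_mul₀ (by positivity) (by positivity) ?_
  have hdom' : (n : ℝ) ≤ 2 * dominationNumber H := by exact_mod_cast hdom
  have hind' : (twoIndependenceNumber H : ℝ) ≤ a + 2 * δ := by exact_mod_cast hind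
  have h3 : (twoIndependenceNumber H : ℝ) ≤ 3 * max (a : ℝ) δ := by
    linarith [le_max_left (a : ℝ) δ, le_max_right (a : ℝ) δ]
  calc (n : ℝ) ≤ 2 * (C * twoIndependenceNumber H) := by linarith
    _ ≤ 2 * (max C 0 * (3 * max (a : ℝ) δ)) := by
      gcongr
      exact le_max_left C 0
    _ = 6 * max C 0 * max (a : ℝ) δ := by ring

/-! ### The slopes bound the ratio -/

/-- Double counting: if a digraph has out-degrees at most `k`, then few vertices have many
in-neighbors in `S`. -/
theorem mul_card_le_of_card_out_le {V : Type u} [DecidableEq V] {out : V → Finset V} {k : ℕ}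
    (hout : ∀ x, #(out x) ≤ k) (S B : Finset V) (N : ℕ)
    (hB : ∀ z ∈ B, N ≤ #{s ∈ S | z ∈ out s}) : N * #B ≤ k * #S := by
  have h1 : #B * N ≤ ∑ z ∈ B, #{s ∈ S | z ∈ out s} := by
    rw [← smul_eq_mul]
    exact card_nsmul_le_sum _ _ _ hB
  have h2 : ∑ s ∈ S, #{z ∈ B | z ∈ out s} = ∑ z ∈ B, #{s ∈ S | z ∈ out s} :=
    sum_card_bipartiteAbove_eq_sum_card_bipartiteBelow fun s z => z ∈ out s
  have h3 : ∑ s ∈ S, #{z ∈ B | z ∈ out s} ≤ #S * k := by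
    rw [← smul_eq_mul]
    refine sum_le_card_nsmul _ _ _ fun s _ => (card_le_card fun z hz => ?_).trans (hout s)
    exact (mem_filter.1 hz).2
  nlinarith

/-- A maximal set among those from which no vertex receives more than `M` edges: together with the
vertices that receive at least `M` edges from it, it dominates. -/
theorem exists_maximal_card_in_le {V : Type u} [Fintype V] [DecidableEq V] (out : V → Finset V)
    (M : ℕ) : ∃ S : Finset V, (∀ z, #{s ∈ S | z ∈ out s} ≤ M) ∧
      ∀ x ∉ S, ∃ z ∈ out x, M ≤ #{s ∈ S | z ∈ out s} := by
  obtain ⟨S, hS, hmax⟩ := exists_max_image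
    ({S | ∀ z, #{s ∈ S | z ∈ out s} ≤ M} : Finset (Finset V)) card ⟨∅, by simp⟩
  simp only [mem_filter, mem_univ, true_and] at hS hmax
  refine ⟨S, hS, fun x hx => ?_⟩
  by_contra! hcon
  have := hmax (insert x S) fun z => by
    rw [filter_insert]
    split_ifs with hz
    · exact (card_insert_le _ _).trans (hcon z hz)
    · exact hS z
  rw [card_insert_of_notMem hx] at this
  omega

/-- If no vertex has two out-neighbors in the independent set `S`, then any two vertices of `S` at
distance two are joined by a path whose middle vertex is an out-neighbor of one of them. As
in-degrees from `S` are bounded, this leaves only a digraph of bounded out-degree to be avoided. -/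
theorem exists_isTwoIndependentSet_of_card_out_inter_le_one {V : Type u} [DecidableEq V]
    {G : SimpleGraph V} {out : V → Finset V} {k M : ℕ} (hout : IsOrientation G out k)
    {S : Finset V} (hM : ∀ z, #{s ∈ S | z ∈ out s} ≤ M) (hadj : ∀ x ∈ S, ∀ y ∈ S, ¬ G.Adj x y)
    (hS : ∀ z, #(out z ∩ S) ≤ 1) :
    ∃ A, IsTwoIndependentSet G A ∧ #S ≤ (2 * (k * (k + M)) + 1) * #A := by
  classical
  obtain ⟨A, hAS, hA, hcard⟩ := exists_independent_of_outdegree_le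
    (fun x y => ∃ z ∈ out x, y ∈ out z ∨ z ∈ out y) (k * (k + M)) S fun x _ => by
      have hsub : ({y ∈ S | ∃ z ∈ out x, y ∈ out z ∨ z ∈ out y} : Finset V) ⊆
          (out x).biUnion fun z => out z ∪ {s ∈ S | z ∈ out s} := by
        intro y hy
        obtain ⟨hyS, z, hz, h⟩ := mem_filter.1 hy
        refine mem_biUnion.2 ⟨z, hz, ?_⟩
        rcases h with h | h
        · exact mem_union_left _ h
        · exact mem_union_right _ (mem_filter.2 ⟨hyS, h⟩)
      refine (card_le_card hsub).trans ((card_biUnion_le_card_mul _ _ (k + M) fun z _ =>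
        (card_union_le _ _).trans (add_le_add (hout.card_le z) (hM z))).trans ?_)
      exact Nat.mul_le_mul_right _ (hout.card_le x)
  refine ⟨A, isTwoIndependentSet_iff.2 fun x hx y hy hxy =>
    ⟨hadj x (hAS hx) y (hAS hy), ?_⟩, hcard⟩
  rintro z ⟨hxz, hzy⟩
  rcases hout.mem_or_mem x z hxz with hz | hz
  · exact hA x hx y hy hxy ⟨z, hz, hout.mem_or_mem z y hzy⟩
  rcases hout.mem_or_mem z y hzy with hz' | hz'
  · exact hxy (card_le_one.1 (hS z) x (mem_inter.2 ⟨hz, hAS hx⟩) y (mem_inter.2 ⟨hz', hAS hy⟩))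
  · exact hA y hy x hx hxy.symm ⟨z, hz', Or.inl hz⟩

/-- The conclusion holds with an explicit constant depending only on the degeneracy `k` and the
bound `c` on the slopes. The maximal set `S` is thinned out to `S₁ ⊇ S₂ ⊇ S₃ ⊇ A`. Only the last
step loses a factor depending on `M`, so that `M` may be chosen large with respect to the losses of
the steps before the cascades are used. -/
theorem GraphClass.HasBoundedSlopes.hasBoundedRatio {𝒢 : GraphClass.{u}} (hmono : 𝒢.IsMonotone)
    (hdeg : 𝒢.HasBoundedAverageDegree) (h : 𝒢.HasBoundedSlopes) : 𝒢.HasBoundedRatio := by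
  classical
  obtain ⟨c₀, hc₀⟩ := h
  obtain ⟨k, hk⟩ := GraphClass.exists_orientation hmono hdeg
  obtain ⟨c, hc1, hc⟩ : ∃ c : ℕ, 1 ≤ c ∧ ∀ (V : Type u) [Finite V] (H : SimpleGraph V)
      (ψ : H.Coloring Color), 𝒢 V H → IsCascade H ψ → slope H ψ ≤ c := by
    refine ⟨max 1 ⌈c₀⌉₊, le_max_left _ _, fun V _ H ψ hH hψ => (hc₀ V H ψ hH hψ).trans ?_⟩
    exact (Nat.le_ceil c₀).trans (by exact_mod_cast le_max_right _ _)
  set p := k + 2 * k * k with hp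
  set q := 2 * p + 1 with hq
  -- `M` is so large that a set of at most `k * #S / M` vertices is negligible.
  set L := 2 * q * c ^ k + 2 * (k + 1) with hL
  set M := k * L + 1 with hMdef
  set r := 2 * (k * (k + M)) + 1 with hr
  refine ⟨((4 * (k + 2)) * q * c ^ k * r : ℕ), fun V _ G hG => ?_⟩
  have := Fintype.ofFinite V
  obtain ⟨out, hout⟩ := hk V G hG
  obtain ⟨S, hM, hmax⟩ := exists_maximal_card_in_le out M
  set Z : Finset V := {z | M ≤ #{s ∈ S | z ∈ out s}} with hZ
  have hZS : M * #Z ≤ k * #S :=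
    mul_card_le_of_card_out_le hout.card_le S Z M fun z hz => (mem_filter.1 hz).2
  have hdom : dominationNumber G ≤ #S + #Z := by
    refine (dominationNumber_le (D := S ∪ Z) fun x => ?_).trans (card_union_le _ _)
    by_cases hx : x ∈ S
    · exact Or.inl (mem_union_left _ hx)
    · obtain ⟨z, hz, hzM⟩ := hmax x hx
      exact Or.inr ⟨z, mem_union_right _ (mem_filter.2 ⟨mem_univ z, hzM⟩), hout.adj x z hz⟩
  -- Vertices of large in-degree from `S`; the threshold makes them at most half of `S`.
  set B : Finset V := {z | 2 * k + 1 ≤ #{s ∈ S | z ∈ out s}} with hB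
  have hBS : (2 * k + 1) * #B ≤ k * #S :=
    mul_card_le_of_card_out_le hout.card_le S B _ fun z hz => (mem_filter.1 hz).2
  have hB2 : 2 * #B ≤ #S := by
    rcases Nat.eq_zero_or_pos k with hk0 | hk0
    · subst hk0
      omega
    · refine le_of_mul_le_mul_left ?_ hk0
      nlinarith
  set S₁ : Finset V := S \ (Z ∪ Z.biUnion out ∪ B) with hS₁
  have hS₁S : S₁ ⊆ S := sdiff_subset
  have hS₁card : #S ≤ 2 * #S₁ + 2 * (k + 1) * #Z := by
    have h1 : #S ≤ #S₁ + #(Z ∪ Z.biUnion out ∪ B) := card_le_card_sdiff_add_card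
    have h2 := card_union_le (Z ∪ Z.biUnion out) B
    have h3 := card_union_le Z (Z.biUnion out)
    have h4 : #(Z.biUnion out) ≤ #Z * k := card_biUnion_le_card_mul _ _ _ fun z _ => hout.card_le z
    nlinarith
  -- Pairs in `S₁` that are adjacent or joined through a vertex of `S` are sparse.
  obtain ⟨S₂, hS₂S₁, hS₂, hS₂card⟩ := exists_independent_of_outdegree_le
    (fun x y => y ∈ out x ∨ ∃ z ∈ S, x ∈ out z ∧ y ∈ out z) p S₁ fun x hx => by
      have hxB : #{s ∈ S | x ∈ out s} ≤ 2 * k := by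
        have : x ∉ B := fun h => (mem_sdiff.1 hx).2 (mem_union_right _ h)
        simp only [hB, mem_filter, mem_univ, true_and] at this
        omega
      have hsub : ({y ∈ S₁ | y ∈ out x ∨ ∃ z ∈ S, x ∈ out z ∧ y ∈ out z} : Finset V) ⊆
          out x ∪ ({s ∈ S | x ∈ out s} : Finset V).biUnion out := by
        intro y hy
        rcases (mem_filter.1 hy).2 with h | ⟨z, hz, hxz, hyz⟩
        · exact mem_union_left _ h
        · exact mem_union_right _ (mem_biUnion.2 ⟨z, mem_filter.2 ⟨hz, hxz⟩, hyz⟩)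
      refine (card_le_card hsub).trans ((card_union_le _ _).trans
        (add_le_add (hout.card_le x) ?_))
      exact (card_biUnion_le_card_mul _ _ k fun z _ => hout.card_le z).trans
        (Nat.mul_le_mul_right _ hxB)
  rw [← hq] at hS₂card
  have hS₂S : S₂ ⊆ S := hS₂S₁.trans hS₁S
  have hadj : ∀ x ∈ S₂, ∀ y ∈ S₂, ¬ G.Adj x y := by
    intro x hx y hy hxy
    rcases hout.mem_or_mem x y hxy with h | h
    · exact hS₂ x hx y hy hxy.ne (Or.inl h)
    · exact hS₂ y hy x hx hxy.ne.symm (Or.inl h)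
  rcases S.eq_empty_or_nonempty with hS | hS
  · have hγ : dominationNumber G = 0 := by
      have hM1 : 1 ≤ M := by omega
      have : #Z = 0 := by
        rw [hS, card_empty, mul_zero] at hZS
        nlinarith
      rw [hS, card_empty] at hdom
      omega
    rw [hγ, Nat.cast_zero]
    positivity
  have hcZ : c ^ k * #Z < #S₂ := by
    by_contra! hle
    have h1 : #S ≤ L * #Z := by
      calc #S ≤ 2 * (q * #S₂) + 2 * (k + 1) * #Z := by linarith
        _ ≤ 2 * (q * (c ^ k * #Z)) + 2 * (k + 1) * #Z := by gcongr
        _ = L * #Z := by rw [hL]; ring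
    have h2 : M * #Z ≤ k * L * #Z := by
      rw [mul_assoc]
      exact hZS.trans (Nat.mul_le_mul_left k h1)
    have h3 : #Z = 0 := by
      rw [hMdef, add_mul] at h2
      omega
    rw [h3, mul_zero] at h1
    exact absurd hS.card_pos (by omega)
  obtain ⟨S₃, hS₃S₂, hS₃card, hS₃⟩ := exists_subset_card_out_inter_le_one hmono hc1 hc hG
    hout.adj Z k S₂
    (Finset.disjoint_left.2 fun x hx hxZ =>
      (mem_sdiff.1 (hS₂S₁ hx)).2 (mem_union_left _ (mem_union_left _ hxZ)))
    (fun z hz => by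
      obtain ⟨a, ha, b, hb, hab⟩ := one_lt_card.1 hz
      rw [mem_inter] at ha hb
      have hzS : z ∉ S := fun h => hS₂ a ha.2 b hb.2 hab (Or.inr ⟨z, h, ha.1, hb.1⟩)
      refine ⟨fun h => hzS (hS₂S h), fun h => (mem_sdiff.1 (hS₂S₁ ha.2)).2
        (mem_union_left _ (mem_union_right _ (mem_biUnion.2 ⟨z, h, ha.1⟩))), ?_⟩
      obtain ⟨w, hw, hwM⟩ := hmax z hzS
      exact ⟨w, mem_filter.2 ⟨mem_univ w, hwM⟩, hout.adj z w hw⟩)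
    (fun z => (card_le_card inter_subset_left).trans ((hout.card_le z).trans k.le_succ)) hcZ
  have hS₃S : S₃ ⊆ S := hS₃S₂.trans hS₂S
  obtain ⟨A, hA, hAcard⟩ := exists_isTwoIndependentSet_of_card_out_inter_le_one hout
    (fun z => (card_le_card (filter_subset_filter _ hS₃S)).trans (hM z))
    (fun x hx y hy => hadj x (hS₃S₂ hx) y (hS₃S₂ hy)) hS₃
  have hZS₁ : #Z ≤ #S₁ := by
    calc #Z ≤ c ^ k * #Z := Nat.le_mul_of_pos_left _ (Nat.pow_pos hc1)
      _ ≤ #S₁ := hcZ.le.trans (card_le_card hS₂S₁)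
  have hfinal : dominationNumber G ≤ 4 * (k + 2) * q * c ^ k * r * twoIndependenceNumber G := by
    calc dominationNumber G ≤ #S + #Z := hdom
      _ ≤ 4 * (k + 2) * #S₁ := by nlinarith
      _ ≤ 4 * (k + 2) * (q * (c ^ k * (r * #A))) := by
        gcongr
        exact hS₂card.trans (Nat.mul_le_mul_left q
          (hS₃card.trans (Nat.mul_le_mul_left _ hAcard)))
      _ ≤ 4 * (k + 2) * (q * (c ^ k * (r * twoIndependenceNumber G))) := by
        gcongr
        exact le_twoIndependenceNumber hA
      _ = 4 * (k + 2) * q * c ^ k * r * twoIndependenceNumber G := by ring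
  exact_mod_cast hfinal

end CascadeRatio

universe u

theorem theorem1 (𝒢 : CascadeRatio.GraphClass.{u}) (hmono : 𝒢.IsMonotone)
    (hdeg : 𝒢.HasBoundedAverageDegree) :
    𝒢.HasBoundedRatio ↔ 𝒢.HasBoundedSlopes :=
  ⟨fun h => h.hasBoundedSlopes, fun h => h.hasBoundedRatio hmono hdeg⟩
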